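/- A MIMO radar has $N$ transmit antennas at positions $\mathbf l^t_n\in\mathbb R^3$ and $M$ receive antennas at positions $\mathbf l^r_m\in\mathbb R^3$, wavelength $\lambda>0$, and a known transmitted signal matrix $X=[x_1,\dots,x_L]\in\mathbb C^{N\times L}$. There are $K$ targets at positions $\mathbf l_k=(x_k,y_k,z_k)\in\mathbb R^3$, none of them at the position of an antenna, with reflection coefficients $b_k\in\mathbb C$. Let $A\in\mathbb C^{M\times K}$ and $V\in\mathbb C^{N\times K}$ have the entries $$A_{mk}=\frac{\lambda}{4\pi\|\mathbf l^r_m-\mathbf l_k\|}\,e^{-\mathrm j\frac{2\pi}{\lambda}\|\mathbf l^r_m-\mathbf l_k\|},\qquad V_{nk}=\frac{\lambda}{4\pi\|\mathbf l^t_n-\mathbf l_k\|}\,e^{-\mathrm j\frac{2\pi}{\lambda}\|\mathbf l^t_n-\mathbf l_k\|},$$ and let $B=\operatorname{diag}(b_1,\dots,b_K)$. The received signal is $Y=ABV^TX+Z\in\mathbb C^{M\times L}$, where the columns of $Z$ are independent, each with the circularly symmetric complex Gaussian distribution $\mathcal{CN}(0,Q)$. The unknown parameter vector $\tilde\theta\in\mathbb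 R^{5K+M^2}$ consists of the $5K$ target parameters $x_k$, $y_k$, $z_k$, $\operatorname{Re}b_k$, $\operatorname{Im}b_k$ ($k=1,\dots,K$) and of $M^2$ real nuisance parameters, of which $Q$ is a function; near the true parameter value $Q$ is Hermitian positive definite, and it is differentiable there. Then the vectorized received signal $y=\operatorname{vec}(Y)$ has the distribution $\mathcal{CN}(\mu(\tilde\theta),C(\tilde\theta))$ with $\mu(\tilde\theta)=\operatorname{vec}(ABV^TX)$ and $C(\tilde\theta)=\operatorname{blockdiag}(Q,\dots,Q)$ ($L$ blocks). The Fisher information matrix $\tilde F$ of $\tilde\theta$, that is, $\tilde F_{ij}=\mathbb E\left[\frac{\partial\log p(y;\tilde\theta)}{\partial\tilde\theta_i}\,\frac{\partial\log p(y;\tilde\theta)}{\partial\tilde\theta_j}\right]$ with $p(\cdot\,;\tilde\theta)$ the Gaussian density of $y$, exists (the derivatives exist and the products are integrable), and for all $i,j$ $$\tilde F_{ij}=L\operatorname{tr}\left[Q^{-1}\frac{\partial Q}{\partial\tilde\theta_i}Q^{-1}\frac{\partial Q}{\partial\tilde\theta_j}\right]+2\operatorname{Re}\operatorname{tr}\left[\left(\frac{\partial(ABV^TX)}{\partial\tilde\theta_i}\right)^{H}Q^{-1}\,\frac{\partial(ABV^TX)}{\partial\tilde\theta_j}\right].$$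 Consequently $\tilde F$ is block diagonal: $\tilde F_{ij}=\tilde F_{ji}=0$ whenever $\tilde\theta_i$ is a target parameter and $\tilde\theta_j$ is a nuisance parameter. -/

import Mathlib

open MeasureTheory Filter Topology
open scoped ComplexOrder Kronecker

noncomputable section

/-- Density, with respect to Lebesgue measure on `ℂⁿ`, of the circularly symmetric complex Gaussian
distribution `CN(μ, C)` with positive definite covariance matrix `C`:
`π⁻ⁿ |C|⁻¹ exp(-(y - μ)ᴴ C⁻¹ (y - μ))`. -/
def complexGaussianPDF {ι : Type*} [Fintype ι] [DecidableEq ι]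
    (μ : ι → ℂ) (C : Matrix ι ι ℂ) (y : ι → ℂ) : ℝ :=
  (Real.pi ^ Fintype.card ι * C.det.re)⁻¹ *
    Real.exp (-(star (y - μ) ⬝ᵥ (C⁻¹.mulVec (y - μ))).re)

/-- The distribution `CN(μ, C)`, for `C` positive definite. -/
def complexGaussian {ι : Type*} [Fintype ι] [DecidableEq ι]
    (μ : ι → ℂ) (C : Matrix ι ι ℂ) : Measure (ι → ℂ) :=
  volume.withDensity (fun y => ENNReal.ofReal (complexGaussianPDF μ C y))

/-- The partial derivative `∂f/∂θᵢ` at `θ`. -/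
def partialDeriv {ι F : Type*} [DecidableEq ι] [NormedAddCommGroup F] [NormedSpace ℝ F]
    (i : ι) (f : (ι → ℝ) → F) (θ : ι → ℝ) : F :=
  lineDeriv ℝ f θ (Pi.single i 1)

/-- The partial derivative `∂f/∂θᵢ` at `θ` of a matrix-valued function, taken entrywise. -/
def matrixPartialDeriv {ι m n : Type*} [DecidableEq ι]
    (i : ι) (f : (ι → ℝ) → Matrix m n ℂ) (θ : ι → ℝ) : Matrix m n ℂ :=
  Matrix.of fun a b => partialDeriv i (fun ϑ => f ϑ a b) θ

/-- The `i`-th component of the score, `∂ log p(y; θ) / ∂θᵢ`, of a likelihood function `p`. -/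
def score {ι Y : Type*} [DecidableEq ι] (p : (ι → ℝ) → Y → ℝ) (θ : ι → ℝ) (y : Y) (i : ι) : ℝ :=
  partialDeriv i (fun ϑ => Real.log (p ϑ y)) θ

/-- The Fisher information matrix at `θ` of the family of distributions `P` with likelihood
function `p`: its `(i, j)` entry is `E_θ[∂ᵢ log p(y; θ) · ∂ⱼ log p(y; θ)]`, where `y ∼ P θ`. -/
def fisherInformation {ι Y : Type*} [DecidableEq ι] [MeasurableSpace Y]
    (P : (ι → ℝ) → Measure Y) (p : (ι → ℝ) → Y → ℝ) (θ : ι → ℝ) : Matrix ι ι ℝ :=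
  Matrix.of fun i j => ∫ y, score p θ y i * score p θ y j ∂(P θ)

/-- The known data of the MIMO radar with `M` receive antennas, `N` transmit antennas and `L`
symbols: wavelength, antenna positions and transmitted signal matrix. -/
structure MIMORadar (M N L : ℕ) where
  wavelength : ℝ
  wavelength_pos : 0 < wavelength
  rxPos : Fin M → EuclideanSpace ℝ (Fin 3)
  txPos : Fin N → EuclideanSpace ℝ (Fin 3)
  X : Matrix (Fin N) (Fin L) ℂ

/-- Indices of the `5K + M²` real unknowns. On the left, in this order, the target parameters
`x₁..x_K, y₁..y_K, z₁..z_K, Re b₁..Re b_K, Im b₁..Im b_K`; on the right the `M²` real nuisance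
parameters of the noise covariance matrix. -/
abbrev ParamIndex (K M : ℕ) : Type := (Fin 5 × Fin K) ⊕ Fin (M ^ 2)

/-- Position `(x_k, y_k, z_k)` of the `k`-th target. -/
def targetPos {K M : ℕ} (θ : ParamIndex K M → ℝ) (k : Fin K) : EuclideanSpace ℝ (Fin 3) :=
  !₂[θ (Sum.inl (0, k)), θ (Sum.inl (1, k)), θ (Sum.inl (2, k))]

/-- Complex reflection coefficient `b_k` of the `k`-th target. -/
def reflCoeff {K M : ℕ} (θ : ParamIndex K M → ℝ) (k : Fin K) : ℂ :=
  ⟨θ (Sum.inl (3, k)), θ (Sum.inl (4, k))⟩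

/-- The nuisance parameters. -/
def nuisance {K M : ℕ} (θ : ParamIndex K M → ℝ) : Fin (M ^ 2) → ℝ := fun i => θ (Sum.inr i)

/-- Channel coefficient `λ / (4π‖p - l‖) · exp(-j (2π/λ) ‖p - l‖)` between an antenna at `p` and a
target at `l`. -/
def channelCoeff (wavelength : ℝ) (p l : EuclideanSpace ℝ (Fin 3)) : ℂ :=
  ((wavelength / (4 * Real.pi * ‖p - l‖) : ℝ) : ℂ) *
    Complex.exp (-Complex.I * ((2 * Real.pi / wavelength * ‖p - l‖ : ℝ) : ℂ))

namespace MIMORadar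

variable {M N L K : ℕ} (R : MIMORadar M N L)

/-- The matrix `A` of receive steering vectors. -/
def A (θ : ParamIndex K M → ℝ) : Matrix (Fin M) (Fin K) ℂ :=
  Matrix.of fun m k => channelCoeff R.wavelength (R.rxPos m) (targetPos θ k)

/-- The matrix `V` of transmit steering vectors. -/
def V (θ : ParamIndex K M → ℝ) : Matrix (Fin N) (Fin K) ℂ :=
  Matrix.of fun n k => channelCoeff R.wavelength (R.txPos n) (targetPos θ k)

/-- The noiseless received signal matrix `A B Vᵀ X`, with `B = diag(b)`. -/
def signal (θ : ParamIndex K M → ℝ) : Matrix (Fin M) (Fin L) ℂ :=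
  R.A θ * Matrix.diagonal (reflCoeff θ) * (R.V θ).transpose * R.X

/-- The mean `μ(θ) = vec(A B Vᵀ X)` of the vectorized received signal (columns stacked). -/
def mean (θ : ParamIndex K M → ℝ) : Fin L × Fin M → ℂ := (R.signal θ).vec

/-- The covariance matrix `blockdiag(Q, …, Q)` with `L` blocks. -/
def blockCov (L : ℕ) (Q : Matrix (Fin M) (Fin M) ℂ) :
    Matrix (Fin L × Fin M) (Fin L × Fin M) ℂ :=
  (1 : Matrix (Fin L) (Fin L) ℂ) ⊗ₖ Q

/-- The law of `y = vec(Y)`, `Y = A B Vᵀ X + Z`, where the `L` columns of `Z` are independent with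
distribution `CN(0, Q)`, and `Q` is a function of the nuisance parameters. -/
def receivedLaw (Q : (Fin (M ^ 2) → ℝ) → Matrix (Fin M) (Fin M) ℂ) (θ : ParamIndex K M → ℝ) :
    Measure (Fin L × Fin M → ℂ) :=
  (Measure.pi fun _ : Fin L => complexGaussian (0 : Fin M → ℂ) (Q (nuisance θ))).map
    fun z => (R.signal θ + Matrix.of fun m l => z l m).vec

/-- The likelihood function `p(y; θ)`: the density of `CN(μ(θ), blockdiag(Q, …, Q))`. -/
def likelihood (Q : (Fin (M ^ 2) → ℝ) → Matrix (Fin M) (Fin M) ℂ) (θ : ParamIndex K M → ℝ)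
    (y : Fin L × Fin M → ℂ) : ℝ :=
  complexGaussianPDF (R.mean θ) (blockCov L (Q (nuisance θ))) y

/-- The Fisher information matrix of all `5K + M²` real unknowns for the observation `y`. -/
def fim (Q : (Fin (M ^ 2) → ℝ) → Matrix (Fin M) (Fin M) ℂ) (θ : ParamIndex K M → ℝ) :
    Matrix (ParamIndex K M) (ParamIndex K M) ℝ :=
  fisherInformation (R.receivedLaw Q) (R.likelihood Q) θ

end MIMORadar

end

/-! Along a coordinate line the log-density of `CN(μ, C)` has derivative `-tr(C⁻¹C') +
(y-μ)ᴴC⁻¹C'C⁻¹(y-μ) + 2 Re μ'ᴴC⁻¹(y-μ)`. This follows from Jacobi's formula and the derivative of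
the inverse (`hasDerivAt_log_complexGaussianPDF`).

The second moment of this score is computed by whitening. As a derivative of Hermitian matrices,
`C'` is Hermitian, so one invertible `T` gives `C = T Tᴴ` and `C' = T diag(d) Tᴴ`. With `y = μ + T
u` the coordinates of `u` are independent `CN(0, 1)`, and the score becomes `∑ (d_a(|u_a|² - 1) + 2
Re(conj(k_a) u_a))` with `k = T⁻¹μ'` (`gaussianScore_congr`). The summands are centred with variance
`d_a² + 2|k_a|²`, and these add up to `tr(C⁻¹C'C⁻¹C') + 2 μ'ᴴC⁻¹μ'`. The score is linear in `(μ',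
C')`, so polarization gives the mixed moments (`integral_gaussianScore_mul`).

For `C = 1 ⊗ Q` the first trace is `L` times a trace in `Q`, and the second term becomes a trace
because `μ` is a `vec`. Target parameters do not move `Q` and nuisance parameters do not move the
signal, so both terms of a mixed entry vanish. -/

/-! ### Simultaneous diagonalization by congruence. -/

open Matrix MatrixOrder in
/-- A positive definite and a Hermitian matrix are simultaneously diagonalized by a congruence. -/
theorem Matrix.PosDef.exists_congr_diagonal {ι : Type*} [Fintype ι] [DecidableEq ι]
    {C H : Matrix ι ι ℂ} (hC : C.PosDef) (hH : H.IsHermitian) :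
    ∃ (T : Matrix ι ι ℂ) (d : ι → ℝ), IsUnit T ∧ C = T * Tᴴ ∧
      H = T * diagonal (fun a => (d a : ℂ)) * Tᴴ := by
  -- `S` whitens `C`. A unitary `U` then diagonalizes the Hermitian matrix `S H Sᴴ`, and `T = S⁻¹U`;
  -- the factor `U` cancels in `T Tᴴ`.
  obtain ⟨S, hS⟩ : ∃ S : Matrix ι ι ℂ, C⁻¹ = Sᴴ * S :=
    CStarAlgebra.nonneg_iff_eq_star_mul_self.1 hC.inv.posSemidef.nonneg
  have hSu : IsUnit S := by
    have h1 : IsUnit (Sᴴ * S) := hS ▸ hC.inv.isUnit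
    rw [Matrix.isUnit_iff_isUnit_det] at h1 ⊢
    rw [det_mul] at h1
    exact isUnit_of_mul_isUnit_right h1
  have hSd : IsUnit S.det := (Matrix.isUnit_iff_isUnit_det S).1 hSu
  have hSdH : IsUnit Sᴴ.det := (Matrix.isUnit_iff_isUnit_det _).1 hSu.star
  have hG : (S * H * Sᴴ).IsHermitian := isHermitian_mul_mul_conjTranspose S hH
  let U : Matrix ι ι ℂ := hG.eigenvectorUnitary
  have hU1 : U * Uᴴ = 1 := Unitary.mul_star_self_of_mem hG.eigenvectorUnitary.2
  have hsp : S * H * Sᴴ = U * diagonal (fun a => (hG.eigenvalues a : ℂ)) * Uᴴ := by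
    conv_lhs => rw [hG.spectral_theorem]
    simp [Unitary.conjStarAlgAut_apply, U, star_eq_conjTranspose]
    rfl
  refine ⟨S⁻¹ * U, hG.eigenvalues, ?_, ?_, ?_⟩
  · refine IsUnit.mul ?_ ?_
    · exact (Matrix.isUnit_nonsing_inv_iff).2 hSu
    · exact IsUnit.of_mul_eq_one _ hU1
  · rw [conjTranspose_mul, conjTranspose_nonsing_inv, Matrix.mul_assoc, ← Matrix.mul_assoc U, hU1,
      Matrix.one_mul, ← mul_inv_rev, ← hS, nonsing_inv_nonsing_inv]
    exact (Matrix.isUnit_iff_isUnit_det _).1 hC.isUnit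
  · calc H = S⁻¹ * (S * H * Sᴴ) * Sᴴ⁻¹ := by
          rw [Matrix.mul_assoc S, nonsing_inv_mul_cancel_left _ _ hSd,
            mul_nonsing_inv_cancel_right _ _ hSdH]
      _ = _ := by
          conv_lhs => rw [hsp]
          rw [conjTranspose_mul, conjTranspose_nonsing_inv]
          simp only [Matrix.mul_assoc]

/-! ### Transport and products of measures with densities. -/

/-- The real determinant of a complex linear map is the norm from `ℂ` to `ℝ` of its complex
determinant, that is, `|det T|²`. -/
theorem Matrix.map_mulVec_volume {ι : Type*} [Fintype ι] [DecidableEq ι] {T : Matrix ι ι ℂ}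
    (hT : IsUnit T) :
    (volume : Measure (ι → ℂ)).map T.mulVec =
      ENNReal.ofReal ((Complex.normSq T.det)⁻¹) • volume := by
  have hdet : LinearMap.det ((Matrix.toLin' T).restrictScalars ℝ) = Complex.normSq T.det := by
    rw [LinearMap.det_restrictScalars, LinearMap.det_toLin', Algebra.norm_complex_apply]
  have hne : LinearMap.det ((Matrix.toLin' T).restrictScalars ℝ) ≠ 0 := by
    rw [hdet, Ne, Complex.normSq_eq_zero]
    exact ((Matrix.isUnit_iff_isUnit_det T).1 hT).ne_zero
  have h := Measure.map_linearMap_addHaar_eq_smul_addHaar (volume : Measure (ι → ℂ)) hne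
  rw [hdet, abs_of_nonneg (inv_nonneg.2 (Complex.normSq_nonneg _))] at h
  exact h

/-- With the density written as `g ∘ f`, no inverse of `f` is needed. -/
theorem MeasureTheory.Measure.map_withDensity_comp {α β : Type*} [MeasurableSpace α]
    [MeasurableSpace β] (μ : Measure α) {f : α → β} (hf : Measurable f) {g : β → ENNReal}
    (hg : Measurable g) : (μ.withDensity (g ∘ f)).map f = (μ.map f).withDensity g := by
  ext s hs
  rw [Measure.map_apply hf hs, withDensity_apply _ (hf hs), withDensity_apply _ hs,
    setLIntegral_map hs hg hf]
  rfl

/-- It suffices to compare the two measures on boxes. There the indicator factors over the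
coordinates and Fubini applies; integrability permits the passage to real integrals. -/
theorem MeasureTheory.Measure.pi_withDensity_ofReal {ι : Type*} [Fintype ι] {E : ι → Type*}
    [∀ i, MeasureSpace (E i)] [∀ i, SigmaFinite (volume : Measure (E i))] {f : ∀ i, E i → ℝ}
    (hf : ∀ i, Integrable (f i)) (hf0 : ∀ i x, 0 ≤ f i x) :
    Measure.pi (fun i => (volume : Measure (E i)).withDensity fun x => ENNReal.ofReal (f i x)) =
      (volume : Measure (∀ i, E i)).withDensity fun x => ENNReal.ofReal (∏ i, f i (x i)) := by
  have : ∀ i, SigmaFinite ((volume : Measure (E i)).withDensity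
      fun x => ENNReal.ofReal (f i x)) := fun i => by
    have := isFiniteMeasure_withDensity_ofReal (hf i).2
    infer_instance
  refine Measure.pi_eq fun s hs => ?_
  have hind : ∀ i, Integrable ((s i).indicator (f i)) := fun i => (hf i).indicator (hs i)
  have hind0 : ∀ i x, 0 ≤ (s i).indicator (f i) x := fun i =>
    Set.indicator_nonneg fun x _ => hf0 i x
  have hprod : ∀ x : ∀ i, E i,
      (Set.univ.pi s).indicator (fun x => ENNReal.ofReal (∏ i, f i (x i))) x =
      ENNReal.ofReal (∏ i, (s i).indicator (f i) (x i)) := fun x => by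
    by_cases hx : x ∈ Set.univ.pi s
    · rw [Set.indicator_of_mem hx]
      congr 1
      exact Finset.prod_congr rfl fun i _ => (Set.indicator_of_mem (hx i trivial) _).symm
    · rw [Set.indicator_of_notMem hx]
      simp only [Set.mem_pi, Set.mem_univ, true_imp_iff, not_forall] at hx
      obtain ⟨i, hi⟩ := hx
      rw [Finset.prod_eq_zero (Finset.mem_univ i) (Set.indicator_of_notMem hi _),
        ENNReal.ofReal_zero]
  rw [withDensity_apply _ (MeasurableSet.univ_pi hs), ← lintegral_indicator
    (MeasurableSet.univ_pi hs)]
  simp_rw [hprod]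
  have hint : Integrable fun x : ∀ i, E i => ∏ i, (s i).indicator (f i) (x i) :=
    Integrable.fintype_prod_dep hind
  rw [← ofReal_integral_eq_lintegral_ofReal hint
    (Eventually.of_forall fun x => Finset.prod_nonneg fun i _ => hind0 i _),
    integral_fintype_prod_volume_eq_prod, ENNReal.ofReal_prod_of_nonneg
    fun i _ => integral_nonneg (hind0 i)]
  refine Finset.prod_congr rfl fun i _ => ?_
  rw [withDensity_apply _ (hs i), ← lintegral_indicator (hs i),
    ofReal_integral_eq_lintegral_ofReal (hind i) (Eventually.of_forall (hind0 i))]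
  refine lintegral_congr fun x => ?_
  by_cases hx : x ∈ s i <;> simp [hx]

theorem MeasureTheory.measurePreserving_uncurry (ι κ : Type*) [Fintype ι] [Fintype κ]
    (X : Type*) [MeasureSpace X] [SigmaFinite (volume : Measure X)] :
    MeasurePreserving (MeasurableEquiv.curry ι κ X).symm := by
  refine ⟨MeasurableEquiv.measurable _, ?_⟩
  refine (Measure.pi_eq fun s hs => ?_).symm
  rw [MeasurableEquiv.map_apply]
  have : (MeasurableEquiv.curry ι κ X).symm ⁻¹' Set.univ.pi s =
      Set.univ.pi fun i => Set.univ.pi fun j => s (i, j) := by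
    ext x
    simp [MeasurableEquiv.curry, Function.uncurry]
  rw [this, volume_pi_pi]
  simp_rw [volume_pi_pi]
  rw [← Finset.univ_product_univ, Finset.prod_product]

/-! ### Moments and symmetries of the standard complex Gaussian. -/

/-- The standard circularly symmetric complex Gaussian distribution `CN(0, 1)` on `ℂ`. -/
noncomputable def stdComplexGaussian : Measure ℂ :=
  volume.withDensity fun z => ENNReal.ofReal (Real.pi⁻¹ * Real.exp (-‖z‖ ^ 2))

theorem integrable_norm_pow_mul_exp_neg_sq (n : ℕ) :
    Integrable (fun z : ℂ => ‖z‖ ^ (2 * n) * Real.exp (-‖z‖ ^ 2)) ∧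
      ∫ z : ℂ, ‖z‖ ^ (2 * n) * Real.exp (-‖z‖ ^ 2) = Real.pi * n.factorial := by
  have h := Complex.integral_rpow_mul_exp_neg_rpow (p := 2) (q := (2 * n : ℕ)) (by norm_num)
    (lt_of_lt_of_le (by norm_num) (Nat.cast_nonneg _))
  have h1 : (((2 * n : ℕ) : ℝ) + 2) / 2 = n + 1 := by push_cast; ring
  rw [h1, Real.Gamma_nat_eq_factorial, mul_div_cancel_left₀ _ two_ne_zero] at h
  have h2 : (fun z : ℂ => ‖z‖ ^ (((2 * n : ℕ) : ℝ)) * Real.exp (-‖z‖ ^ (2 : ℝ))) =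
      fun z : ℂ => ‖z‖ ^ (2 * n) * Real.exp (-‖z‖ ^ 2) := by
    ext z
    rw [Real.rpow_natCast, Real.rpow_two]
  rw [h2] at h
  -- A non-integrable function has integral `0` by convention, so a nonzero value proves
  -- integrability.
  refine ⟨Integrable.of_integral_ne_zero ?_, h⟩
  rw [h]
  positivity

theorem integrable_stdComplexGaussian_iff {f : ℂ → ℝ} :
    Integrable f stdComplexGaussian ↔
      Integrable fun z => Real.pi⁻¹ * Real.exp (-‖z‖ ^ 2) * f z := by
  rw [stdComplexGaussian, integrable_withDensity_iff_integrable_smul' (by fun_prop)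
    (Eventually.of_forall fun _ => ENNReal.ofReal_lt_top)]
  refine integrable_congr (Eventually.of_forall fun z => ?_)
  simp only [smul_eq_mul]
  rw [ENNReal.toReal_ofReal (by positivity)]

theorem integral_stdComplexGaussian (f : ℂ → ℝ) :
    ∫ z, f z ∂stdComplexGaussian = ∫ z, Real.pi⁻¹ * Real.exp (-‖z‖ ^ 2) * f z := by
  rw [stdComplexGaussian, integral_withDensity_eq_integral_toReal_smul (by fun_prop)
    (Eventually.of_forall fun _ => ENNReal.ofReal_lt_top)]
  refine integral_congr_ae (Eventually.of_forall fun z => ?_)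
  simp only [smul_eq_mul]
  rw [ENNReal.toReal_ofReal (by positivity)]

theorem integrable_norm_pow_stdComplexGaussian (n : ℕ) :
    Integrable (fun z : ℂ => ‖z‖ ^ (2 * n)) stdComplexGaussian := by
  rw [integrable_stdComplexGaussian_iff]
  refine ((integrable_norm_pow_mul_exp_neg_sq n).1.const_mul Real.pi⁻¹).congr
    (Eventually.of_forall fun z => ?_)
  dsimp only
  ring

theorem integral_norm_pow_stdComplexGaussian (n : ℕ) :
    ∫ z : ℂ, ‖z‖ ^ (2 * n) ∂stdComplexGaussian = n.factorial := by
  rw [integral_stdComplexGaussian]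
  calc _ = ∫ z : ℂ, Real.pi⁻¹ * (‖z‖ ^ (2 * n) * Real.exp (-‖z‖ ^ 2)) := by
        congr 1; ext z; ring
    _ = _ := by
        rw [integral_const_mul, (integrable_norm_pow_mul_exp_neg_sq n).2,
          inv_mul_cancel_left₀ Real.pi_ne_zero]

instance : IsProbabilityMeasure stdComplexGaussian := by
  refine ⟨?_⟩
  have h := integrable_norm_pow_mul_exp_neg_sq 0
  simp only [mul_zero, pow_zero, one_mul, Nat.factorial_zero, Nat.cast_one, mul_one] at h
  rw [stdComplexGaussian, withDensity_apply _ MeasurableSet.univ, setLIntegral_univ,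
    ← ofReal_integral_eq_lintegral_ofReal (h.1.const_mul _)
      (Eventually.of_forall fun z => by positivity), integral_const_mul, h.2,
    inv_mul_cancel₀ Real.pi_ne_zero, ENNReal.ofReal_one]

/-- A rotation preserves Lebesgue measure, and the density depends only on the norm. -/
theorem measurePreserving_rotation_stdComplexGaussian (c : Circle) :
    MeasurePreserving (rotation c) stdComplexGaussian stdComplexGaussian := by
  refine ⟨(rotation c).continuous.measurable, ?_⟩
  have h := Measure.map_withDensity_comp (volume : Measure ℂ) (rotation c).continuous.measurable
    (g := fun z => ENNReal.ofReal (Real.pi⁻¹ * Real.exp (-‖z‖ ^ 2))) (by fun_prop)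
  rw [(rotation c).measurePreserving.map_eq] at h
  simp only [Function.comp_def, LinearIsometryEquiv.norm_map] at h
  exact h

theorem integral_mul_stdComplexGaussian (f : ℂ → ℝ) {c : ℂ} (hc : ‖c‖ = 1) :
    ∫ z, f (c * z) ∂stdComplexGaussian = ∫ z, f z ∂stdComplexGaussian :=
  (measurePreserving_rotation_stdComplexGaussian
      ⟨c, mem_sphere_zero_iff_norm.2 hc⟩).integral_comp
    (rotation _).toHomeomorph.measurableEmbedding f

theorem integral_odd_stdComplexGaussian {f : ℂ → ℝ} (hf : ∀ z, f (-z) = -f z) :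
    ∫ z, f z ∂stdComplexGaussian = 0 := by
  have h := integral_mul_stdComplexGaussian f (c := -1) (by simp)
  simp only [neg_one_mul, hf, integral_neg] at h
  linarith

theorem memLp_normSq_sub_one_stdComplexGaussian :
    MemLp (fun z : ℂ => ‖z‖ ^ 2 - 1) 2 stdComplexGaussian := by
  refine MemLp.sub (f := fun z : ℂ => ‖z‖ ^ 2) (g := fun _ => (1 : ℝ)) ?_ (memLp_const 1)
  rw [memLp_two_iff_integrable_sq (by fun_prop)]
  simpa only [← pow_mul] using integrable_norm_pow_stdComplexGaussian 2

theorem memLp_re_conj_mul_stdComplexGaussian (k : ℂ) :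
    MemLp (fun z : ℂ => (star k * z).re) 2 stdComplexGaussian := by
  have h : MemLp (fun z : ℂ => ‖k‖ * ‖z‖) 2 stdComplexGaussian := by
    refine MemLp.const_mul ?_ _
    rw [memLp_two_iff_integrable_sq (by fun_prop)]
    simpa using integrable_norm_pow_stdComplexGaussian 1
  refine h.mono (by fun_prop) (Eventually.of_forall fun z => ?_)
  rw [norm_mul, norm_norm, norm_norm, ← norm_star k, ← norm_mul]
  exact Complex.abs_re_le_norm _

/-- Rotation by `i` turns the real part of `conj(k) z` into minus its imaginary part. The two
squares therefore have equal means, and their sum `|k|²|z|²` has mean `|k|²`. -/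
theorem integral_re_conj_mul_sq_stdComplexGaussian (k : ℂ) :
    ∫ z : ℂ, (star k * z).re ^ 2 ∂stdComplexGaussian = ‖k‖ ^ 2 / 2 := by
  have h := integral_mul_stdComplexGaussian (fun z => (star k * z).re ^ 2) Complex.norm_I
  have h1 : ∀ z, (star k * (Complex.I * z)).re ^ 2 = ‖k‖ ^ 2 * ‖z‖ ^ 2 - (star k * z).re ^ 2 := by
    intro z
    rw [← mul_pow, ← norm_star k, ← norm_mul, ← Complex.normSq_eq_norm_sq, Complex.normSq_apply]
    simp only [Complex.mul_re, Complex.mul_im, Complex.I_re, Complex.I_im]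
    ring
  have h2 := integral_norm_pow_stdComplexGaussian 1
  have h3 := integrable_norm_pow_stdComplexGaussian 1
  simp only [mul_one, Nat.factorial_one, Nat.cast_one] at h2 h3
  simp only [h1] at h
  rw [integral_sub (h3.const_mul _) (memLp_re_conj_mul_stdComplexGaussian k).integrable_sq,
    integral_const_mul, h2] at h
  linarith

/-! ### The whitened score: mean and variance. -/

/-- The score of a one-dimensional complex Gaussian distribution in whitened coordinates. -/
noncomputable def whiteScore (d : ℝ) (k z : ℂ) : ℝ := d * (‖z‖ ^ 2 - 1) + 2 * (star k * z).re

theorem memLp_whiteScore (d : ℝ) (k : ℂ) : MemLp (whiteScore d k) 2 stdComplexGaussian :=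
  (memLp_normSq_sub_one_stdComplexGaussian.const_mul d).add
    ((memLp_re_conj_mul_stdComplexGaussian k).const_mul 2)

theorem integral_whiteScore (d : ℝ) (k : ℂ) : ∫ z, whiteScore d k z ∂stdComplexGaussian = 0 := by
  have h2 := integral_norm_pow_stdComplexGaussian 1
  have h3 := integrable_norm_pow_stdComplexGaussian 1
  simp only [mul_one, Nat.factorial_one, Nat.cast_one] at h2 h3
  simp only [whiteScore]
  rw [integral_add
    ((memLp_normSq_sub_one_stdComplexGaussian.integrable one_le_two).const_mul d)
    (((memLp_re_conj_mul_stdComplexGaussian k).integrable one_le_two).const_mul 2),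
    integral_const_mul, integral_const_mul, integral_sub h3 (integrable_const 1), h2,
    integral_odd_stdComplexGaussian (f := fun z => (star k * z).re) (fun z => by simp)]
  simp

/-- The cross term is odd and drops out. The fourth and second moments give `E(|z|² - 1)² = 2 - 2 +
1 = 1`, and the linear part contributes `4 · |k|²/2`. -/
theorem variance_whiteScore (d : ℝ) (k : ℂ) :
    ProbabilityTheory.variance (whiteScore d k) stdComplexGaussian = d ^ 2 + 2 * ‖k‖ ^ 2 := by
  rw [ProbabilityTheory.variance_of_integral_eq_zero (memLp_whiteScore d k).aemeasurable
    (integral_whiteScore d k)]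
  have hA := memLp_normSq_sub_one_stdComplexGaussian
  have hB := memLp_re_conj_mul_stdComplexGaussian k
  have hA2 : ∫ z : ℂ, (‖z‖ ^ 2 - 1) ^ 2 ∂stdComplexGaussian = 1 := by
    have h2 := integral_norm_pow_stdComplexGaussian 1
    have h3 := integrable_norm_pow_stdComplexGaussian 1
    have h4 := integral_norm_pow_stdComplexGaussian 2
    have h5 := integrable_norm_pow_stdComplexGaussian 2
    simp only [mul_one, Nat.factorial_one, Nat.cast_one] at h2 h3
    have : ∀ z : ℂ, (‖z‖ ^ 2 - 1) ^ 2 = ‖z‖ ^ (2 * 2) - 2 * ‖z‖ ^ 2 + 1 := fun z => by ring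
    simp only [this]
    have h6 : Integrable (fun z : ℂ => ‖z‖ ^ (2 * 2) - 2 * ‖z‖ ^ 2) stdComplexGaussian :=
      h5.sub (h3.const_mul 2)
    rw [integral_add h6 (integrable_const 1),
      integral_sub h5 (h3.const_mul 2), integral_const_mul, h2, h4]
    norm_num
  have hAB : ∫ z : ℂ, (‖z‖ ^ 2 - 1) * (star k * z).re ∂stdComplexGaussian = 0 :=
    integral_odd_stdComplexGaussian fun z => by
      rw [norm_neg, mul_neg, Complex.neg_re, mul_neg]
  have hexp : ∀ z, (whiteScore d k z) ^ 2 = d ^ 2 * (‖z‖ ^ 2 - 1) ^ 2 +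
      4 * d * ((‖z‖ ^ 2 - 1) * (star k * z).re) + 4 * (star k * z).re ^ 2 := fun z => by
    rw [whiteScore]; ring
  simp only [hexp]
  have i1 : Integrable (fun z : ℂ => d ^ 2 * (‖z‖ ^ 2 - 1) ^ 2) stdComplexGaussian :=
    hA.integrable_sq.const_mul _
  have i2 : Integrable (fun z : ℂ => 4 * d * ((‖z‖ ^ 2 - 1) * (star k * z).re))
      stdComplexGaussian := (hA.integrable_mul hB).const_mul _
  have i3 : Integrable (fun z : ℂ => d ^ 2 * (‖z‖ ^ 2 - 1) ^ 2 +
      4 * d * ((‖z‖ ^ 2 - 1) * (star k * z).re)) stdComplexGaussian := i1.add i2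
  rw [integral_add i3 (hB.integrable_sq.const_mul _), integral_add i1 i2, integral_const_mul, integral_const_mul,
    integral_const_mul, hA2, hAB, integral_re_conj_mul_sq_stdComplexGaussian]
  ring

section Pi

variable {ι : Type*} [Fintype ι] (d : ι → ℝ) (k : ι → ℂ)

theorem memLp_sum_whiteScore :
    MemLp (fun u : ι → ℂ => ∑ a, whiteScore (d a) (k a) (u a)) 2
      (Measure.pi fun _ => stdComplexGaussian) :=
  memLp_finsetSum _ fun a _ =>
    (memLp_whiteScore (d a) (k a)).comp_measurePreserving (measurePreserving_eval _ a)

/-- Variances of independent coordinates add, and the mean is zero, so the second moment is the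
variance. -/
theorem integral_sum_whiteScore_sq :
    ∫ u : ι → ℂ, (∑ a, whiteScore (d a) (k a) (u a)) ^ 2
      ∂(Measure.pi fun _ => stdComplexGaussian) = ∑ a, (d a ^ 2 + 2 * ‖k a‖ ^ 2) := by
  have h := ProbabilityTheory.variance_sum_pi fun a => memLp_whiteScore (d a) (k a)
  simp only [variance_whiteScore] at h
  rw [← h]
  have hs : (∑ a, fun u : ι → ℂ => whiteScore (d a) (k a) (u a)) =
      fun u : ι → ℂ => ∑ a, whiteScore (d a) (k a) (u a) := by
    ext u; simp
  rw [hs, ProbabilityTheory.variance_of_integral_eq_zero (memLp_sum_whiteScore d k).aemeasurable]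
  have hint : ∀ a, Integrable (fun u : ι → ℂ => whiteScore (d a) (k a) (u a))
      (Measure.pi fun _ => stdComplexGaussian) := fun a =>
    ((memLp_whiteScore (d a) (k a)).comp_measurePreserving
      (measurePreserving_eval _ a)).integrable one_le_two
  rw [integral_finsetSum _ fun a _ => hint a]
  refine Finset.sum_eq_zero fun a _ => ?_
  rw [integral_comp_eval (memLp_whiteScore (d a) (k a)).aestronglyMeasurable, integral_whiteScore]

end Pi

/-! ### The multivariate complex Gaussian and the moments of its score. -/

theorem pi_stdComplexGaussian {ι : Type*} [Fintype ι] :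
    (Measure.pi fun _ : ι => stdComplexGaussian) = (volume : Measure (ι → ℂ)).withDensity
      fun u => ENNReal.ofReal ((Real.pi ^ Fintype.card ι)⁻¹ * Real.exp (-∑ a, ‖u a‖ ^ 2)) := by
  have hint : Integrable fun z : ℂ => Real.pi⁻¹ * Real.exp (-‖z‖ ^ 2) := by
    simpa using (integrable_norm_pow_mul_exp_neg_sq 0).1.const_mul Real.pi⁻¹
  have h := Measure.pi_withDensity_ofReal (fun _ : ι => hint) (fun _ _ => by positivity)
  refine h.trans ?_
  congr with u
  rw [Finset.prod_mul_distrib, ← Real.exp_sum, Finset.prod_const, inv_pow,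
    Finset.sum_neg_distrib]
  rfl

section Gaussian

variable {ι : Type*} [Fintype ι] [DecidableEq ι]

theorem complexGaussianPDF_nonneg (μ : ι → ℂ) {C : Matrix ι ι ℂ} (hC : C.PosDef) (y : ι → ℂ) :
    0 ≤ complexGaussianPDF μ C y := by
  have := (Complex.pos_iff.1 hC.det_pos).1
  rw [complexGaussianPDF]
  positivity

theorem measurable_complexGaussianPDF (μ : ι → ℂ) (C : Matrix ι ι ℂ) :
    Measurable (complexGaussianPDF μ C) := by
  unfold complexGaussianPDF
  exact (by fun_prop : Continuous fun y : ι → ℂ => (Real.pi ^ Fintype.card ι * C.det.re)⁻¹ *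
    Real.exp (-(star (y - μ) ⬝ᵥ (C⁻¹.mulVec (y - μ))).re)).measurable

open Matrix in
/-- `CN(μ, T Tᴴ)` is the law of `μ + T u` for `u` standard complex Gaussian. -/
theorem complexGaussian_eq_map {T : Matrix ι ι ℂ} (hT : IsUnit T) (μ : ι → ℂ) :
    complexGaussian μ (T * Tᴴ) =
      (Measure.pi fun _ : ι => stdComplexGaussian).map fun u => μ + T *ᵥ u := by
  have hTd : IsUnit T.det := (Matrix.isUnit_iff_isUnit_det T).1 hT
  have hTdH : IsUnit Tᴴ.det := (Matrix.isUnit_iff_isUnit_det _).1 hT.star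
  have hn : 0 < Complex.normSq T.det := Complex.normSq_pos.2 hTd.ne_zero
  have hmeas : Measurable fun u : ι → ℂ => μ + T *ᵥ u :=
    (by fun_prop : Continuous fun u : ι → ℂ => μ + T *ᵥ u).measurable
  have hvol : (volume : Measure (ι → ℂ)).map (fun u => μ + T *ᵥ u) =
      ENNReal.ofReal (Complex.normSq T.det)⁻¹ • volume := by
    have h := Matrix.map_mulVec_volume hT
    have h1 : (fun u : ι → ℂ => μ + T *ᵥ u) = (fun u => μ + u) ∘ T.mulVec := rfl
    rw [h1, ← Measure.map_map (measurable_const_add μ)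
      (by fun_prop : Continuous T.mulVec).measurable, h, Measure.map_smul,
      (measurePreserving_add_left volume μ).map_eq]
  -- The factor `|det T|²` here cancels against the Jacobian in `hvol`.
  have hpdf : ∀ u, (Real.pi ^ Fintype.card ι)⁻¹ * Real.exp (-∑ a, ‖u a‖ ^ 2) =
      Complex.normSq T.det * complexGaussianPDF μ (T * Tᴴ) (μ + T *ᵥ u) := by
    intro u
    have hdet : (T * Tᴴ).det.re = Complex.normSq T.det := by
      rw [det_mul, det_conjTranspose, ← starRingEnd_apply, Complex.mul_conj, Complex.ofReal_re]
    have hq : (star (T *ᵥ u) ⬝ᵥ ((T * Tᴴ)⁻¹ *ᵥ (T *ᵥ u))).re = ∑ a, ‖u a‖ ^ 2 := by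
      rw [mulVec_mulVec, Matrix.mul_inv_rev, Matrix.mul_assoc, nonsing_inv_mul _ hTd, Matrix.mul_one,
        star_mulVec, ← dotProduct_mulVec, mulVec_mulVec, mul_nonsing_inv _ hTdH, one_mulVec,
        dotProduct, Complex.re_sum]
      refine Finset.sum_congr rfl fun a _ => ?_
      rw [Pi.star_apply, ← Complex.normSq_eq_norm_sq, Complex.star_def,
        ← Complex.normSq_eq_conj_mul_self, Complex.ofReal_re]
    rw [complexGaussianPDF, add_sub_cancel_left, hdet, hq]
    field_simp
  have hgm : Measurable fun y : ι → ℂ => ENNReal.ofReal (Complex.normSq T.det) *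
      ENNReal.ofReal (complexGaussianPDF μ (T * Tᴴ) y) :=
    (measurable_complexGaussianPDF μ _).ennreal_ofReal.const_mul _
  have h := Measure.map_withDensity_comp (volume : Measure (ι → ℂ)) hmeas hgm
  rw [hvol] at h
  rw [pi_stdComplexGaussian]
  simp_rw [hpdf, ENNReal.ofReal_mul hn.le]
  refine Eq.trans ?_ h.symm
  rw [withDensity_smul_measure]
  have := withDensity_smul (μ := (volume : Measure (ι → ℂ))) (ENNReal.ofReal (Complex.normSq T.det))
    (measurable_complexGaussianPDF μ (T * Tᴴ)).ennreal_ofReal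
  refine Eq.trans ?_ (congrArg _ this.symm)
  rw [smul_smul, ← ENNReal.ofReal_mul (by positivity), inv_mul_cancel₀ hn.ne', ENNReal.ofReal_one,
    one_smul]
  rfl

theorem isProbabilityMeasure_complexGaussian (μ : ι → ℂ) {C : Matrix ι ι ℂ} (hC : C.PosDef) :
    IsProbabilityMeasure (complexGaussian μ C) := by
  -- Only the factorization `C = T Tᴴ` is wanted, so the second matrix is taken to be `0`.
  obtain ⟨T, -, hT, rfl, -⟩ := hC.exists_congr_diagonal Matrix.isHermitian_zero
  rw [complexGaussian_eq_map hT]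
  exact Measure.isProbabilityMeasure_map
    (by fun_prop : Continuous fun u : ι → ℂ => μ + T.mulVec u).measurable.aemeasurable

theorem integrable_complexGaussianPDF (μ : ι → ℂ) {C : Matrix ι ι ℂ} (hC : C.PosDef) :
    Integrable (complexGaussianPDF μ C) := by
  refine ⟨(measurable_complexGaussianPDF μ C).aestronglyMeasurable, ?_⟩
  rw [hasFiniteIntegral_iff_ofReal (Eventually.of_forall (complexGaussianPDF_nonneg μ hC))]
  have h := (isProbabilityMeasure_complexGaussian μ hC).measure_univ
  rw [complexGaussian, withDensity_apply _ MeasurableSet.univ, setLIntegral_univ] at h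
  rw [h]
  exact ENNReal.one_lt_top

open Matrix

/-- The derivative of the log-density of `CN(μ, C)` at `y` in the direction of increments `μ'` of
the mean and `C'` of the covariance matrix. -/
noncomputable def gaussianScore (μ : ι → ℂ) (C : Matrix ι ι ℂ) (μ' : ι → ℂ) (C' : Matrix ι ι ℂ)
    (y : ι → ℂ) : ℝ :=
  -(C⁻¹ * C').trace.re + (star (y - μ) ⬝ᵥ ((C⁻¹ * C' * C⁻¹) *ᵥ (y - μ))).re +
    2 * (star μ' ⬝ᵥ (C⁻¹ *ᵥ (y - μ))).re

theorem gaussianScore_add (μ : ι → ℂ) (C : Matrix ι ι ℂ) (μ₁ μ₂ : ι → ℂ) (C₁ C₂ : Matrix ι ι ℂ)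
    (y : ι → ℂ) : gaussianScore μ C (μ₁ + μ₂) (C₁ + C₂) y =
      gaussianScore μ C μ₁ C₁ y + gaussianScore μ C μ₂ C₂ y := by
  simp only [gaussianScore, Matrix.mul_add, Matrix.add_mul, trace_add, add_mulVec, dotProduct_add,
    star_add, add_dotProduct, Complex.add_re]
  ring

theorem gaussianScore_sub (μ : ι → ℂ) (C : Matrix ι ι ℂ) (μ₁ μ₂ : ι → ℂ) (C₁ C₂ : Matrix ι ι ℂ)
    (y : ι → ℂ) : gaussianScore μ C (μ₁ - μ₂) (C₁ - C₂) y =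
      gaussianScore μ C μ₁ C₁ y - gaussianScore μ C μ₂ C₂ y := by
  simp only [gaussianScore, Matrix.mul_sub, Matrix.sub_mul, trace_sub, sub_mulVec, dotProduct_sub,
    star_sub, sub_dotProduct, Complex.sub_re]
  ring

/-- Substituting `y - μ = T u` cancels every `T`: the trace becomes `∑ d_a`, the quadratic form `∑
d_a|u_a|²`, and the mean increment enters as `T⁻¹μ'`. -/
theorem gaussianScore_congr {T : Matrix ι ι ℂ} (hT : IsUnit T) (d : ι → ℝ) (μ μ' u : ι → ℂ) :
    gaussianScore μ (T * Tᴴ) μ' (T * diagonal (fun a => (d a : ℂ)) * Tᴴ) (μ + T *ᵥ u) =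
      ∑ a, whiteScore (d a) ((T⁻¹ *ᵥ μ') a) (u a) := by
  have hTd : IsUnit T.det := (Matrix.isUnit_iff_isUnit_det T).1 hT
  have hTdH : IsUnit Tᴴ.det := (Matrix.isUnit_iff_isUnit_det _).1 hT.star
  have h1 : (T * Tᴴ)⁻¹ * (T * diagonal (fun a => (d a : ℂ)) * Tᴴ) =
      Tᴴ⁻¹ * diagonal (fun a => (d a : ℂ)) * Tᴴ := by
    rw [Matrix.mul_inv_rev]
    simp only [Matrix.mul_assoc]
    rw [nonsing_inv_mul_cancel_left _ _ hTd]
  have htr : (Tᴴ⁻¹ * diagonal (fun a => (d a : ℂ)) * Tᴴ).trace.re = ∑ a, d a := by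
    rw [trace_mul_cycle, mul_nonsing_inv _ hTdH, Matrix.one_mul, trace_diagonal, Complex.re_sum]
    simp
  have hq : (star (T *ᵥ u) ⬝ᵥ ((Tᴴ⁻¹ * diagonal (fun a => (d a : ℂ)) * Tᴴ * (T * Tᴴ)⁻¹) *ᵥ
      (T *ᵥ u))).re = ∑ a, d a * ‖u a‖ ^ 2 := by
    have : Tᴴ * (Tᴴ⁻¹ * diagonal (fun a => (d a : ℂ)) * Tᴴ * (T * Tᴴ)⁻¹ * T) =
        diagonal (fun a => (d a : ℂ)) := by
      rw [Matrix.mul_inv_rev]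
      simp only [Matrix.mul_assoc]
      rw [nonsing_inv_mul _ hTd, Matrix.mul_one, mul_nonsing_inv_cancel_left _ _ hTdH,
        mul_nonsing_inv _ hTdH, Matrix.mul_one]
    rw [mulVec_mulVec, star_mulVec, ← dotProduct_mulVec, mulVec_mulVec, this, dotProduct,
      Complex.re_sum]
    refine Finset.sum_congr rfl fun a _ => ?_
    rw [mulVec_diagonal, Pi.star_apply, ← Complex.normSq_eq_norm_sq, mul_left_comm,
      Complex.star_def, ← Complex.normSq_eq_conj_mul_self, ← Complex.ofReal_mul,
      Complex.ofReal_re]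
  have hl : (star μ' ⬝ᵥ ((T * Tᴴ)⁻¹ *ᵥ (T *ᵥ u))).re =
      ∑ a, (star ((T⁻¹ *ᵥ μ') a) * u a).re := by
    rw [mulVec_mulVec, Matrix.mul_inv_rev, Matrix.mul_assoc, nonsing_inv_mul _ hTd, Matrix.mul_one,
      dotProduct_mulVec, ← conjTranspose_nonsing_inv, ← star_mulVec, dotProduct, Complex.re_sum]
    rfl
  rw [gaussianScore, add_sub_cancel_left, h1, htr, hq, hl]
  simp only [whiteScore, mul_sub, mul_one, Finset.sum_add_distrib, Finset.sum_sub_distrib,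
    Finset.mul_sum]
  ring

theorem measurable_gaussianScore (μ : ι → ℂ) (C : Matrix ι ι ℂ) (μ' : ι → ℂ)
    (C' : Matrix ι ι ℂ) : Measurable (gaussianScore μ C μ' C') := by
  have : Continuous (gaussianScore μ C μ' C') := by
    unfold gaussianScore
    fun_prop
  exact this.measurable

theorem memLp_gaussianScore {C : Matrix ι ι ℂ} (hC : C.PosDef) (μ : ι → ℂ)
    (μ' : ι → ℂ) {C' : Matrix ι ι ℂ} (hC' : C'.IsHermitian) :
    MemLp (gaussianScore μ C μ' C') 2 (complexGaussian μ C) := by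
  obtain ⟨T, d, hT, rfl, rfl⟩ := hC.exists_congr_diagonal hC'
  rw [complexGaussian_eq_map hT, memLp_map_measure_iff
    (measurable_gaussianScore _ _ _ _).aestronglyMeasurable
    (by fun_prop : Continuous fun u : ι → ℂ => μ + T *ᵥ u).measurable.aemeasurable]
  simp only [Function.comp_def, gaussianScore_congr hT]
  exact memLp_sum_whiteScore _ _

theorem integral_gaussianScore_sq {C : Matrix ι ι ℂ} (hC : C.PosDef) (μ : ι → ℂ)
    (μ' : ι → ℂ) {C' : Matrix ι ι ℂ} (hC' : C'.IsHermitian) :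
    ∫ y, gaussianScore μ C μ' C' y ^ 2 ∂(complexGaussian μ C) =
      (C⁻¹ * C' * C⁻¹ * C').trace.re + 2 * (star μ' ⬝ᵥ (C⁻¹ *ᵥ μ')).re := by
  obtain ⟨T, d, hT, rfl, rfl⟩ := hC.exists_congr_diagonal hC'
  have hTd : IsUnit T.det := (Matrix.isUnit_iff_isUnit_det T).1 hT
  have hTdH : IsUnit Tᴴ.det := (Matrix.isUnit_iff_isUnit_det _).1 hT.star
  rw [complexGaussian_eq_map hT, integral_map
    (by fun_prop : Continuous fun u : ι → ℂ => μ + T *ᵥ u).measurable.aemeasurable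
    ((measurable_gaussianScore _ _ _ _).pow_const 2).aestronglyMeasurable]
  simp only [gaussianScore_congr hT]
  rw [integral_sum_whiteScore_sq, Finset.sum_add_distrib, ← Finset.mul_sum]
  congr 1
  · have h1 : (T * Tᴴ)⁻¹ * (T * diagonal (fun a => (d a : ℂ)) * Tᴴ) * (T * Tᴴ)⁻¹ *
        (T * diagonal (fun a => (d a : ℂ)) * Tᴴ) =
        Tᴴ⁻¹ * (diagonal (fun a => (d a : ℂ)) * diagonal (fun a => (d a : ℂ))) * Tᴴ := by
      rw [Matrix.mul_inv_rev]
      simp only [Matrix.mul_assoc]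
      rw [nonsing_inv_mul_cancel_left _ _ hTd, nonsing_inv_mul_cancel_left _ _ hTd,
        mul_nonsing_inv_cancel_left _ _ hTdH]
    rw [h1, trace_mul_cycle, mul_nonsing_inv _ hTdH, Matrix.one_mul, diagonal_mul_diagonal,
      trace_diagonal, Complex.re_sum]
    refine Finset.sum_congr rfl fun a _ => ?_
    rw [← Complex.ofReal_mul, Complex.ofReal_re, sq]
  · have h2 : star μ' ⬝ᵥ ((T * Tᴴ)⁻¹ *ᵥ μ') = star (T⁻¹ *ᵥ μ') ⬝ᵥ (T⁻¹ *ᵥ μ') := by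
      rw [star_mulVec, ← dotProduct_mulVec, mulVec_mulVec, Matrix.mul_inv_rev, conjTranspose_nonsing_inv]
    rw [h2, dotProduct, Complex.re_sum]
    congr 1
    refine Finset.sum_congr rfl fun a _ => ?_
    rw [Pi.star_apply, ← Complex.normSq_eq_norm_sq, Complex.star_def,
      ← Complex.normSq_eq_conj_mul_self, Complex.ofReal_re]

/-- Polarization of `integral_gaussianScore_sq`. The right-hand side is symmetric in the two
increments, by cyclicity of the trace and because `C⁻¹` is Hermitian. -/
theorem integral_gaussianScore_mul {C : Matrix ι ι ℂ} (hC : C.PosDef) (μ : ι → ℂ)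
    (μ₁ μ₂ : ι → ℂ) {C₁ C₂ : Matrix ι ι ℂ} (hC₁ : C₁.IsHermitian)
    (hC₂ : C₂.IsHermitian) :
    ∫ y, gaussianScore μ C μ₁ C₁ y * gaussianScore μ C μ₂ C₂ y ∂(complexGaussian μ C) =
      (C⁻¹ * C₁ * C⁻¹ * C₂).trace.re + 2 * (star μ₁ ⬝ᵥ (C⁻¹ *ᵥ μ₂)).re := by
  have hpol : ∀ y, gaussianScore μ C μ₁ C₁ y * gaussianScore μ C μ₂ C₂ y =
      4⁻¹ * (gaussianScore μ C (μ₁ + μ₂) (C₁ + C₂) y ^ 2 -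
        gaussianScore μ C (μ₁ - μ₂) (C₁ - C₂) y ^ 2) := fun y => by
    rw [gaussianScore_add, gaussianScore_sub]
    ring
  simp only [hpol]
  rw [integral_const_mul, integral_sub
    (memLp_gaussianScore hC μ _ (hC₁.add hC₂)).integrable_sq
    (memLp_gaussianScore hC μ _ (hC₁.sub hC₂)).integrable_sq,
    integral_gaussianScore_sq hC μ _ (hC₁.add hC₂), integral_gaussianScore_sq hC μ _ (hC₁.sub hC₂)]
  have htr : (C⁻¹ * C₂ * C⁻¹ * C₁).trace = (C⁻¹ * C₁ * C⁻¹ * C₂).trace := by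
    rw [Matrix.mul_assoc, trace_mul_comm, ← Matrix.mul_assoc]
  have hdot : (star μ₂ ⬝ᵥ (C⁻¹ *ᵥ μ₁)).re = (star μ₁ ⬝ᵥ (C⁻¹ *ᵥ μ₂)).re := by
    have h : star μ₂ ⬝ᵥ (C⁻¹ *ᵥ μ₁) = star (star μ₁ ⬝ᵥ (C⁻¹ *ᵥ μ₂)) := by
      rw [star_dotProduct, star_mulVec, hC.inv.isHermitian.eq, dotProduct_mulVec]
    rw [h, Complex.star_def, Complex.conj_re]
  simp only [Matrix.mul_add, Matrix.add_mul, Matrix.mul_sub, Matrix.sub_mul, trace_add, trace_sub,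
    mulVec_add, mulVec_sub, star_add, star_sub, dotProduct_add, add_dotProduct, dotProduct_sub,
    sub_dotProduct, Complex.add_re, Complex.sub_re, htr, hdot]
  ring

end Gaussian

/-! ### Derivatives of determinants, inverses and the Gaussian log-density. -/

section MatrixDerivative

open Matrix

variable {l m n : Type*} {t₀ : ℝ}

theorem hasDerivAt_matrix_mul [Fintype m] {A : ℝ → Matrix l m ℂ} {B : ℝ → Matrix m n ℂ}
    {A' : Matrix l m ℂ} {B' : Matrix m n ℂ}
    (hA : ∀ a b, HasDerivAt (fun t => A t a b) (A' a b) t₀)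
    (hB : ∀ a b, HasDerivAt (fun t => B t a b) (B' a b) t₀) (a : l) (b : n) :
    HasDerivAt (fun t => (A t * B t) a b) ((A' * B t₀ + A t₀ * B') a b) t₀ := by
  simp only [Matrix.mul_apply, Matrix.add_apply, ← Finset.sum_add_distrib]
  exact HasDerivAt.fun_sum fun j _ => (hA a j).mul (hB j b)

theorem hasDerivAt_mulVec [Fintype m] {A : ℝ → Matrix l m ℂ} {v : ℝ → m → ℂ}
    {A' : Matrix l m ℂ} {v' : m → ℂ}
    (hA : ∀ a b, HasDerivAt (fun t => A t a b) (A' a b) t₀)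
    (hv : ∀ a, HasDerivAt (fun t => v t a) (v' a) t₀) (a : l) :
    HasDerivAt (fun t => (A t *ᵥ v t) a) ((A' *ᵥ v t₀ + A t₀ *ᵥ v') a) t₀ := by
  simp only [mulVec, dotProduct, Pi.add_apply, ← Finset.sum_add_distrib]
  exact HasDerivAt.fun_sum fun j _ => (hA a j).mul (hv j)

theorem hasDerivAt_dotProduct [Fintype m] {v w : ℝ → m → ℂ} {v' w' : m → ℂ}
    (hv : ∀ a, HasDerivAt (fun t => v t a) (v' a) t₀)
    (hw : ∀ a, HasDerivAt (fun t => w t a) (w' a) t₀) :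
    HasDerivAt (fun t => v t ⬝ᵥ w t) (v' ⬝ᵥ w t₀ + v t₀ ⬝ᵥ w') t₀ := by
  simp only [dotProduct, ← Finset.sum_add_distrib]
  exact HasDerivAt.fun_sum fun j _ => (hv j).mul (hw j)

/-- Uniqueness of derivatives, applied to an entry and the conjugate of its transposed entry. -/
theorem isHermitian_of_hasDerivAt {C : ℝ → Matrix n n ℂ} {C' : Matrix n n ℂ}
    (hC : ∀ a b, HasDerivAt (fun t => C t a b) (C' a b) t₀)
    (hherm : ∀ᶠ t in 𝓝 t₀, (C t).IsHermitian) : C'.IsHermitian := by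
  ext a b
  refine (hC b a).star.unique ((hC a b).congr_of_eventuallyEq ?_)
  filter_upwards [hherm] with t ht
  exact ht.apply a b

variable [Fintype n] [DecidableEq n]

/-- **Jacobi's formula** for the derivative of a determinant. -/
theorem hasDerivAt_det {C : ℝ → Matrix n n ℂ} {C' : Matrix n n ℂ}
    (hC : ∀ a b, HasDerivAt (fun t => C t a b) (C' a b) t₀) :
    HasDerivAt (fun t => (C t).det) ((C t₀).adjugate * C').trace t₀ := by
  have h : HasDerivAt (fun t => (C t).det) (∑ σ : Equiv.Perm n, (Equiv.Perm.sign σ : ℂ) *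
      ∑ i, (∏ j ∈ Finset.univ.erase i, C t₀ (σ j) j) • C' (σ i) i) t₀ := by
    simp only [det_apply']
    exact HasDerivAt.fun_sum fun σ _ =>
      (HasDerivAt.fun_finsetProd fun i _ => hC (σ i) i).const_mul _
  convert! h using 1
  -- Cramer's rule: the diagonal entries are determinants with one column differentiated, which are
  -- the terms of the product rule.
  have hi : ∀ i, ((C t₀).adjugate * C') i i = ((C t₀).updateCol i fun a => C' a i).det := by
    intro i
    rw [← cramer_apply, cramer_eq_adjugate_mulVec]
    rfl
  simp only [trace, diag_apply, hi, det_apply', Finset.mul_sum]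
  rw [Finset.sum_comm]
  refine Finset.sum_congr rfl fun σ _ => Finset.sum_congr rfl fun i _ => ?_
  rw [← Finset.mul_prod_erase _ _ (Finset.mem_univ i), updateCol_self, smul_eq_mul,
    mul_comm (C' _ _)]
  congr 2
  exact Finset.prod_congr rfl fun j hj => updateCol_ne (Finset.ne_of_mem_erase hj)

/-- The formula `adjugate / det` gives differentiability; the value then comes from differentiating
`C C⁻¹ = 1`. -/
theorem hasDerivAt_matrix_inv {C : ℝ → Matrix n n ℂ} {C' : Matrix n n ℂ}
    (hC : ∀ a b, HasDerivAt (fun t => C t a b) (C' a b) t₀)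
    (hunit : ∀ᶠ t in 𝓝 t₀, IsUnit (C t)) (a b : n) :
    HasDerivAt (fun t => (C t)⁻¹ a b) ((-((C t₀)⁻¹ * C' * (C t₀)⁻¹)) a b) t₀ := by
  have hu : ∀ᶠ t in 𝓝 t₀, IsUnit (C t).det :=
    hunit.mono fun t ht => (Matrix.isUnit_iff_isUnit_det _).1 ht
  have hu0 := hu.self_of_nhds
  have hdiff : ∀ a b, DifferentiableAt ℝ (fun t => (C t)⁻¹ a b) t₀ := by
    intro a b
    simp only [inv_def, Ring.inverse_eq_inv', Matrix.smul_apply, smul_eq_mul, adjugate_apply]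
    refine DifferentiableAt.mul ((hasDerivAt_det hC).differentiableAt.inv hu0.ne_zero) ?_
    -- An adjugate entry is the determinant of `C t` with row `b` replaced by a constant vector, so
    -- that row has derivative `0`.
    refine (hasDerivAt_det (C' := C'.updateRow b 0) fun c d => ?_).differentiableAt
    by_cases hc : c = b
    · subst hc
      simpa using hasDerivAt_const t₀ _
    · simpa [hc] using hC c d
  let D : Matrix n n ℂ := of fun a b => deriv (fun t => (C t)⁻¹ a b) t₀
  have hD : ∀ a b, HasDerivAt (fun t => (C t)⁻¹ a b) (D a b) t₀ := fun a b =>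
    (hdiff a b).hasDerivAt
  have hzero : C' * (C t₀)⁻¹ + C t₀ * D = 0 := by
    ext a b
    refine (hasDerivAt_matrix_mul hC hD a b).unique ?_
    refine (hasDerivAt_const t₀ ((1 : Matrix n n ℂ) a b)).congr_of_eventuallyEq ?_
    filter_upwards [hu] with t ht
    rw [mul_nonsing_inv _ ht]
  have hDeq : D = -((C t₀)⁻¹ * C' * (C t₀)⁻¹) := by
    rw [← nonsing_inv_mul_cancel_left _ D hu0, eq_neg_of_add_eq_zero_right hzero, Matrix.mul_neg,
      Matrix.mul_assoc]
  exact hDeq ▸ hD a b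

theorem hasDerivAt_log_complexGaussianPDF {μ : ℝ → n → ℂ} {C : ℝ → Matrix n n ℂ} {μ' : n → ℂ}
    {C' : Matrix n n ℂ} (hμ : ∀ a, HasDerivAt (fun t => μ t a) (μ' a) t₀)
    (hC : ∀ a b, HasDerivAt (fun t => C t a b) (C' a b) t₀)
    (hpos : ∀ᶠ t in 𝓝 t₀, (C t).PosDef) (y : n → ℂ) :
    HasDerivAt (fun t => Real.log (complexGaussianPDF (μ t) (C t) y))
      (gaussianScore (μ t₀) (C t₀) μ' C' y) t₀ := by
  have hp0 := hpos.self_of_nhds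
  have hw : ∀ a, HasDerivAt (fun t => (y - μ t) a) ((-μ') a) t₀ := fun a =>
    (hμ a).const_sub (y a)
  have hws : ∀ a, HasDerivAt (fun t => star (y - μ t) a) (star (-μ') a) t₀ := fun a =>
    (hw a).star
  have hinv := hasDerivAt_matrix_inv hC (hpos.mono fun t ht => ht.isUnit)
  have hq := hasDerivAt_dotProduct hws (hasDerivAt_mulVec hinv hw)
  have hqre := Complex.reCLM.hasFDerivAt.comp_hasDerivAt t₀ hq
  have hdet := Complex.reCLM.hasFDerivAt.comp_hasDerivAt t₀ (hasDerivAt_det hC)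
  have hd0 := Complex.pos_iff.1 hp0.det_pos
  have hlog := (hdet.const_mul (Real.pi ^ Fintype.card n)).log
    (mul_pos (by positivity) hd0.1).ne'
  have h := hlog.neg.sub hqre
  refine (h.congr_of_eventuallyEq ?_).congr_deriv ?_
  · filter_upwards [hpos] with t ht
    have hd := (Complex.pos_iff.1 ht.det_pos).1
    rw [complexGaussianPDF, Real.log_mul (by positivity) (Real.exp_pos _).ne', Real.log_exp,
      Real.log_inv]
    rfl
  · have hadj : (C t₀).adjugate * C' = (C t₀).det • ((C t₀)⁻¹ * C') := by
      rw [inv_def, Ring.inverse_eq_inv', Matrix.smul_mul, smul_smul,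
        mul_inv_cancel₀ hp0.det_pos.ne', one_smul]
    have hcross : (star (y - μ t₀) ⬝ᵥ ((C t₀)⁻¹ *ᵥ μ')).re =
        (star μ' ⬝ᵥ ((C t₀)⁻¹ *ᵥ (y - μ t₀))).re := by
      have h : star (y - μ t₀) ⬝ᵥ ((C t₀)⁻¹ *ᵥ μ') =
          star (star μ' ⬝ᵥ ((C t₀)⁻¹ *ᵥ (y - μ t₀))) := by
        rw [star_dotProduct, star_mulVec, hp0.inv.isHermitian.eq, dotProduct_mulVec]
      rw [h, Complex.star_def, Complex.conj_re]
    -- The determinant of a positive definite matrix is real, so it factors out of the real part.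
    have hdetre : ((C t₀).adjugate * C').trace.re =
        (C t₀).det.re * ((C t₀)⁻¹ * C').trace.re := by
      rw [hadj, trace_smul, smul_eq_mul, Complex.mul_re, ← hd0.2]
      ring
    simp only [Complex.reCLM_apply, Function.comp_apply, hdetre, gaussianScore, neg_mulVec,
      mulVec_neg, dotProduct_add, dotProduct_neg, star_neg, neg_dotProduct, Complex.add_re,
      Complex.neg_re, hcross]
    have := hd0.1
    field_simp
    ring

end MatrixDerivative

/-! ### Differentiability of the noiseless signal. -/

theorem differentiable_targetPos {K M : ℕ} (k : Fin K) :
    Differentiable ℝ fun θ : ParamIndex K M → ℝ => targetPos θ k := by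
  intro θ
  refine (differentiableAt_euclidean (𝕜 := ℝ)).2 fun i => ?_
  fin_cases i <;> simp [targetPos] <;> fun_prop

theorem differentiableAt_channelCoeff (w : ℝ) {p l : EuclideanSpace ℝ (Fin 3)} (h : l ≠ p) :
    DifferentiableAt ℝ (channelCoeff w p) l := by
  have hn : DifferentiableAt ℝ (fun x => ‖p - x‖) l :=
    ((differentiableAt_const p).sub differentiableAt_id).norm ℝ (sub_ne_zero.2 h.symm)
  have h0 : 4 * Real.pi * ‖p - l‖ ≠ 0 :=
    mul_ne_zero (by positivity) (norm_ne_zero_iff.2 (sub_ne_zero.2 h.symm))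
  have ho : Differentiable ℝ (fun x : ℝ => (x : ℂ)) := Complex.ofRealCLM.differentiable
  have h1 : DifferentiableAt ℝ (fun x => w / (4 * Real.pi * ‖p - x‖)) l := by
    simp only [div_eq_mul_inv]
    exact ((hn.const_mul _).fun_inv h0).const_mul w
  have h2 : DifferentiableAt ℝ (fun x => 2 * Real.pi / w * ‖p - x‖) l := hn.const_mul _
  have h3 := (ho _).comp l h1
  have h4 := (((ho _).comp l h2).const_mul (-Complex.I)).cexp
  exact h3.mul h4

theorem differentiable_reflCoeff {K M : ℕ} (k : Fin K) :
    Differentiable ℝ fun θ : ParamIndex K M → ℝ => reflCoeff θ k := by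
  have ho : Differentiable ℝ (fun x : ℝ => (x : ℂ)) := Complex.ofRealCLM.differentiable
  have h : (fun θ : ParamIndex K M → ℝ => reflCoeff θ k) = fun θ =>
      ((θ (Sum.inl (3, k)) : ℝ) : ℂ) + ((θ (Sum.inl (4, k)) : ℝ) : ℂ) * Complex.I := by
    ext θ
    exact (Complex.mk_eq_add_mul_I _ _)
  rw [h]
  exact (ho.comp (differentiable_apply _)).add ((ho.comp (differentiable_apply _)).mul_const _)

theorem MIMORadar.differentiableAt_signal {M N L K : ℕ} (R : MIMORadar M N L)
    {θ : ParamIndex K M → ℝ} (hrx : ∀ k m, targetPos θ k ≠ R.rxPos m)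
    (htx : ∀ k n, targetPos θ k ≠ R.txPos n) (m : Fin M) (l : Fin L) :
    DifferentiableAt ℝ (fun ϑ : ParamIndex K M → ℝ => R.signal ϑ m l) θ := by
  have hA : ∀ m k, DifferentiableAt ℝ (fun ϑ : ParamIndex K M → ℝ => R.A ϑ m k) θ := fun m k =>
    DifferentiableAt.comp (g := channelCoeff R.wavelength (R.rxPos m)) θ
      (differentiableAt_channelCoeff R.wavelength (hrx k m)) (differentiable_targetPos k θ)
  have hV : ∀ n k, DifferentiableAt ℝ (fun ϑ : ParamIndex K M → ℝ => R.V ϑ n k) θ := fun n k =>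
    DifferentiableAt.comp (g := channelCoeff R.wavelength (R.txPos n)) θ
      (differentiableAt_channelCoeff R.wavelength (htx k n)) (differentiable_targetPos k θ)
  simp only [MIMORadar.signal]
  simp_rw [Matrix.mul_apply (N := R.X), Matrix.mul_apply (N := (R.V _).transpose),
    Matrix.mul_diagonal, Matrix.transpose_apply]
  exact DifferentiableAt.fun_sum fun n _ => (DifferentiableAt.fun_sum fun k _ =>
    ((hA m k).mul (differentiable_reflCoeff k θ)).mul (hV n k)).mul_const _

/-! ### The block covariance and the law of the received signal. -/

namespace MIMORadar

open Matrix

variable {M : ℕ} (L : ℕ)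

theorem posDef_blockCov {Q : Matrix (Fin M) (Fin M) ℂ} (hQ : Q.PosDef) :
    (blockCov L Q).PosDef :=
  PosDef.one.kronecker hQ

theorem blockCov_inv (Q : Matrix (Fin M) (Fin M) ℂ) : (blockCov L Q)⁻¹ = blockCov L Q⁻¹ := by
  rw [blockCov, inv_kronecker, inv_one, blockCov]

theorem blockCov_mul (Q Q' : Matrix (Fin M) (Fin M) ℂ) :
    blockCov L Q * blockCov L Q' = blockCov L (Q * Q') := by
  rw [blockCov, blockCov, ← mul_kronecker_mul, Matrix.one_mul, blockCov]

theorem trace_blockCov (Q : Matrix (Fin M) (Fin M) ℂ) : (blockCov L Q).trace = L * Q.trace := by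
  rw [blockCov, trace_kronecker, trace_one, Fintype.card_fin]

/-- `(1 ⊗ Q) vec Y = vec(Q Y)`, and the inner product of two `vec`s is the trace pairing. -/
theorem star_vec_dotProduct_blockCov_mulVec_vec (Q : Matrix (Fin M) (Fin M) ℂ)
    (X Y : Matrix (Fin M) (Fin L) ℂ) :
    star X.vec ⬝ᵥ (blockCov L Q *ᵥ Y.vec) = (Xᴴ * Q * Y).trace := by
  rw [blockCov, ← vec_mul_eq_mulVec, star_vec_dotProduct_vec, Matrix.mul_assoc]

theorem complexGaussianPDF_blockCov {Q : Matrix (Fin M) (Fin M) ℂ} (hQ : Q.PosDef)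
    (μ : Fin L × Fin M → ℂ) (z : Fin L → Fin M → ℂ) :
    complexGaussianPDF μ (blockCov L Q) (μ + (MeasurableEquiv.curry _ _ _).symm z) =
      ∏ l, complexGaussianPDF 0 Q (z l) := by
  -- The real part commutes with the `L`-th power only because `det Q` is real.
  have hdet : (blockCov L Q).det.re = Q.det.re ^ L := by
    have h : Q.det = (Q.det.re : ℂ) :=
      Complex.ext rfl (by simpa using (Complex.pos_iff.1 hQ.det_pos).2.symm)
    rw [blockCov, det_kronecker, det_one, one_pow, one_mul, Fintype.card_fin]
    conv_lhs => rw [h]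
    rw [← Complex.ofReal_pow, Complex.ofReal_re]
  have hq : star ((MeasurableEquiv.curry _ _ _).symm z) ⬝ᵥ
      (blockCov L Q⁻¹ *ᵥ ((MeasurableEquiv.curry _ _ _).symm z)) =
      ∑ l, star (z l) ⬝ᵥ (Q⁻¹ *ᵥ z l) := by
    have h : (MeasurableEquiv.curry _ _ _).symm z = vec (of fun m l => z l m) := rfl
    rw [h, star_vec_dotProduct_blockCov_mulVec_vec, Matrix.mul_assoc]
    rfl
  simp only [complexGaussianPDF, Finset.prod_mul_distrib, Finset.prod_const, ← Real.exp_sum,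
    add_sub_cancel_left, sub_zero, blockCov_inv, hq, hdet, Finset.card_univ, Fintype.card_fin,
    Fintype.card_prod, Complex.re_sum, Finset.sum_neg_distrib]
  rw [inv_pow, mul_pow, ← pow_mul, mul_comm M L]

variable {L} {N K : ℕ} (R : MIMORadar M N L)

/-- Uncurrying and translation preserve Lebesgue measure, so the claim reduces to the factorization
`complexGaussianPDF_blockCov` of the density. -/
theorem receivedLaw_eq (Q : (Fin (M ^ 2) → ℝ) → Matrix (Fin M) (Fin M) ℂ)
    (θ : ParamIndex K M → ℝ) (hQ : (Q (nuisance θ)).PosDef) :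
    R.receivedLaw Q θ = complexGaussian (R.mean θ) (blockCov L (Q (nuisance θ))) := by
  have hf : (fun z : Fin L → Fin M → ℂ => (R.signal θ + Matrix.of fun m l => z l m).vec) =
      (fun y => R.mean θ + y) ∘ (MeasurableEquiv.curry _ _ _).symm := rfl
  have hmeas : Measurable ((fun y : Fin L × Fin M → ℂ => R.mean θ + y) ∘
      (MeasurableEquiv.curry (Fin L) (Fin M) ℂ).symm) :=
    (measurable_const_add _).comp (MeasurableEquiv.measurable _)
  have hvol : (volume : Measure (Fin L → Fin M → ℂ)).map ((fun y => R.mean θ + y) ∘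
      (MeasurableEquiv.curry (Fin L) (Fin M) ℂ).symm) = volume :=
    ((measurePreserving_add_left volume (R.mean θ)).comp
      (measurePreserving_uncurry (Fin L) (Fin M) ℂ)).map_eq
  have h := Measure.map_withDensity_comp (volume : Measure (Fin L → Fin M → ℂ)) hmeas
    (measurable_complexGaussianPDF (R.mean θ) (blockCov L (Q (nuisance θ)))).ennreal_ofReal
  rw [hvol] at h
  rw [receivedLaw, hf]
  refine Eq.trans ?_ h
  congr 1
  refine (Measure.pi_withDensity_ofReal (fun _ : Fin L => integrable_complexGaussianPDF 0 hQ)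
    fun _ => complexGaussianPDF_nonneg 0 hQ).trans ?_
  congr with z
  simp only [Function.comp_apply]
  rw [complexGaussianPDF_blockCov L hQ]

end MIMORadar

/-! ### Partial derivatives in the target and nuisance directions. -/

theorem hasDerivAt_partialDeriv {ι F : Type*} [DecidableEq ι] [NormedAddCommGroup F]
    [NormedSpace ℝ F] {i : ι} {f : (ι → ℝ) → F} {θ : ι → ℝ}
    (h : LineDifferentiableAt ℝ f θ (Pi.single i 1)) :
    HasDerivAt (fun t : ℝ => f (θ + t • Pi.single i 1)) (partialDeriv i f θ) 0 :=
  h.hasLineDerivAt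

theorem partialDeriv_eq_zero {ι F : Type*} [DecidableEq ι] [NormedAddCommGroup F]
    [NormedSpace ℝ F] {i : ι} {f : (ι → ℝ) → F} {θ : ι → ℝ}
    (h : ∀ t : ℝ, f (θ + t • Pi.single i 1) = f θ) : partialDeriv i f θ = 0 := by
  simp [partialDeriv, lineDeriv, h]

namespace MIMORadar

open Matrix

variable {M N L K : ℕ} (R : MIMORadar M N L)

theorem nuisance_add_single_inl (θ : ParamIndex K M → ℝ) (i : Fin 5 × Fin K) (t : ℝ) :
    nuisance (θ + t • Pi.single (Sum.inl i) 1) = nuisance θ := by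
  ext j
  simp [nuisance]

theorem signal_add_single_inr (θ : ParamIndex K M → ℝ) (j : Fin (M ^ 2)) (t : ℝ) :
    R.signal (θ + t • Pi.single (Sum.inr j) 1) = R.signal θ := by
  have h : ∀ i : Fin 5 × Fin K,
      (θ + t • Pi.single (Sum.inr j) 1 : ParamIndex K M → ℝ) (Sum.inl i) = θ (Sum.inl i) := by
    intro i
    simp
  have hp : (targetPos (θ + t • Pi.single (Sum.inr j) 1) : Fin K → _) = targetPos θ := by
    ext1 k
    simp only [targetPos, h]
  have hb : (reflCoeff (θ + t • Pi.single (Sum.inr j) 1) : Fin K → _) = reflCoeff θ := by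
    ext1 k
    simp only [reflCoeff, h]
  simp only [signal, A, V, hp, hb]

theorem matrixPartialDeriv_nuisance_inl (Q : (Fin (M ^ 2) → ℝ) → Matrix (Fin M) (Fin M) ℂ)
    (θ : ParamIndex K M → ℝ) (i : Fin 5 × Fin K) :
    matrixPartialDeriv (Sum.inl i) (fun ϑ : ParamIndex K M → ℝ => Q (nuisance ϑ)) θ = 0 := by
  ext a b
  exact partialDeriv_eq_zero (f := fun ϑ => Q (nuisance ϑ) a b) fun t => by
    rw [nuisance_add_single_inl]

theorem matrixPartialDeriv_signal_inr (θ : ParamIndex K M → ℝ) (j : Fin (M ^ 2)) :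
    matrixPartialDeriv (Sum.inr j) R.signal θ = 0 := by
  ext a b
  exact partialDeriv_eq_zero (f := fun ϑ => R.signal ϑ a b) fun t => by
    rw [signal_add_single_inr]

theorem differentiableAt_comp_nuisance {F : Type*} [NormedAddCommGroup F] [NormedSpace ℝ F]
    {f : (Fin (M ^ 2) → ℝ) → F} {θ : ParamIndex K M → ℝ}
    (hf : DifferentiableAt ℝ f (nuisance θ)) :
    DifferentiableAt ℝ (fun ϑ : ParamIndex K M → ℝ => f (nuisance ϑ)) θ := by
  have h : DifferentiableAt ℝ (nuisance : (ParamIndex K M → ℝ) → _) θ := by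
    unfold nuisance
    fun_prop
  exact hf.comp θ h

theorem eventually_nuisance {P : (Fin (M ^ 2) → ℝ) → Prop} {θ : ParamIndex K M → ℝ}
    (hP : ∀ᶠ q in 𝓝 (nuisance θ), P q) (v : ParamIndex K M → ℝ) :
    ∀ᶠ t : ℝ in 𝓝 0, P (nuisance (θ + t • v)) := by
  have hc : Continuous fun t : ℝ => nuisance (θ + t • v) := by
    unfold nuisance
    fun_prop
  have h := hc.tendsto 0
  simp only [zero_smul, add_zero] at h
  exact h.eventually hP

variable {R} {Q : (Fin (M ^ 2) → ℝ) → Matrix (Fin M) (Fin M) ℂ} {θ : ParamIndex K M → ℝ}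

theorem hasDerivAt_log_likelihood (hQpos : ∀ᶠ q in 𝓝 (nuisance θ), (Q q).PosDef)
    {i : ParamIndex K M}
    (hQ : ∀ m n, LineDifferentiableAt ℝ
      (fun ϑ : ParamIndex K M → ℝ => Q (nuisance ϑ) m n) θ (Pi.single i 1))
    (hS : ∀ m l, LineDifferentiableAt ℝ (fun ϑ => R.signal ϑ m l) θ (Pi.single i 1))
    (y : Fin L × Fin M → ℂ) :
    HasDerivAt (fun t : ℝ => Real.log (R.likelihood Q (θ + t • Pi.single i 1) y))
      (gaussianScore (R.mean θ) (blockCov L (Q (nuisance θ)))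
        (matrixPartialDeriv i R.signal θ).vec
        (blockCov L (matrixPartialDeriv i (fun ϑ => Q (nuisance ϑ)) θ)) y) 0 := by
  have h := hasDerivAt_log_complexGaussianPDF (t₀ := 0)
    (μ := fun t => R.mean (θ + t • Pi.single i 1))
    (C := fun t => blockCov L (Q (nuisance (θ + t • Pi.single i 1))))
    (μ' := (matrixPartialDeriv i R.signal θ).vec)
    (C' := blockCov L (matrixPartialDeriv i (fun ϑ => Q (nuisance ϑ)) θ))
    (fun a => hasDerivAt_partialDeriv (hS a.2 a.1))
    (fun a b => by
      simp only [blockCov]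
      exact (hasDerivAt_partialDeriv (hQ a.2 b.2)).const_mul _)
    ((eventually_nuisance hQpos _).mono fun t ht => posDef_blockCov L ht) y
  simp only [zero_smul, add_zero] at h
  exact h

theorem isHermitian_matrixPartialDeriv (hQpos : ∀ᶠ q in 𝓝 (nuisance θ), (Q q).PosDef)
    {i : ParamIndex K M}
    (hQ : ∀ m n, LineDifferentiableAt ℝ
      (fun ϑ : ParamIndex K M → ℝ => Q (nuisance ϑ) m n) θ (Pi.single i 1)) :
    (matrixPartialDeriv i (fun ϑ => Q (nuisance ϑ)) θ).IsHermitian :=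
  isHermitian_of_hasDerivAt (fun a b => hasDerivAt_partialDeriv (hQ a b))
    ((eventually_nuisance hQpos _).mono fun _ ht => ht.isHermitian)

theorem isHermitian_blockCov {Q : Matrix (Fin M) (Fin M) ℂ} (hQ : Q.IsHermitian) :
    (blockCov L Q).IsHermitian := by
  rw [IsHermitian, blockCov, conjTranspose_kronecker, conjTranspose_one, hQ.eq]

end MIMORadar

/-! ### The Fisher information matrix. -/

/-- `tr(P H₁ P H₂)` is real for Hermitian `P`, `H₁`, `H₂`. -/
theorem Matrix.IsHermitian.ofReal_re_trace_mul {n : Type*} [Fintype n] {P H₁ H₂ : Matrix n n ℂ}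
    (hP : P.IsHermitian) (h₁ : H₁.IsHermitian) (h₂ : H₂.IsHermitian) :
    ((P * H₁ * P * H₂).trace.re : ℂ) = (P * H₁ * P * H₂).trace := by
  rw [← Complex.conj_eq_iff_re, starRingEnd_apply, ← Matrix.trace_conjTranspose]
  simp only [Matrix.conjTranspose_mul, hP.eq, h₁.eq, h₂.eq]
  rw [Matrix.trace_mul_comm, ← Matrix.mul_assoc, Matrix.trace_mul_comm]

theorem proposition1 {M N L K : ℕ} (R : MIMORadar M N L)
    -- the noise covariance matrix as a function of its `M²` real parameters
    (Q : (Fin (M ^ 2) → ℝ) → Matrix (Fin M) (Fin M) ℂ)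
    (θ : ParamIndex K M → ℝ)
    (hQpos : ∀ᶠ q in 𝓝 (nuisance θ), (Q q).PosDef)
    (hQdiff : ∀ m n, DifferentiableAt ℝ (fun q => Q q m n) (nuisance θ))
    -- no target sits on an antenna
    (hrx : ∀ k m, targetPos θ k ≠ R.rxPos m)
    (htx : ∀ k n, targetPos θ k ≠ R.txPos n) :
    -- the received signal has distribution `CN(μ, blockdiag(Q, …, Q))`
    (∀ ϑ : ParamIndex K M → ℝ, (Q (nuisance ϑ)).PosDef →
      R.receivedLaw Q ϑ =
        complexGaussian (R.mean ϑ) (MIMORadar.blockCov L (Q (nuisance ϑ)))) ∧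
    -- the derivatives and the expectations below exist
    (∀ i m l, LineDifferentiableAt ℝ (fun ϑ => R.signal ϑ m l) θ (Pi.single i 1)) ∧
    (∀ i m n, LineDifferentiableAt ℝ
      (fun ϑ : ParamIndex K M → ℝ => Q (nuisance ϑ) m n) θ (Pi.single i 1)) ∧
    (∀ i y, LineDifferentiableAt ℝ
      (fun ϑ => Real.log (R.likelihood Q ϑ y)) θ (Pi.single i 1)) ∧
    (∀ i j, Integrable
      (fun y => score (R.likelihood Q) θ y i * score (R.likelihood Q) θ y j)
      (R.receivedLaw Q θ)) ∧
    -- the entries of the Fisher information matrix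
    (∀ i j, ((R.fim Q θ i j : ℝ) : ℂ) =
      (L : ℂ) * ((Q (nuisance θ))⁻¹ * matrixPartialDeriv i (fun ϑ => Q (nuisance ϑ)) θ *
          (Q (nuisance θ))⁻¹ * matrixPartialDeriv j (fun ϑ => Q (nuisance ϑ)) θ).trace +
        ((2 * ((matrixPartialDeriv i R.signal θ).conjTranspose * (Q (nuisance θ))⁻¹ *
          matrixPartialDeriv j R.signal θ).trace.re : ℝ) : ℂ)) ∧
    -- block diagonality between target parameters and nuisance parameters
    (∀ (i : Fin 5 × Fin K) (j : Fin (M ^ 2)),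
      R.fim Q θ (Sum.inl i) (Sum.inr j) = 0 ∧ R.fim Q θ (Sum.inr j) (Sum.inl i) = 0) := by
  have hQ : ∀ i m n, LineDifferentiableAt ℝ
      (fun ϑ : ParamIndex K M → ℝ => Q (nuisance ϑ) m n) θ (Pi.single i 1) := fun i m n =>
    (MIMORadar.differentiableAt_comp_nuisance (hQdiff m n)).lineDifferentiableAt
  have hS : ∀ i m l, LineDifferentiableAt ℝ (fun ϑ => R.signal ϑ m l) θ (Pi.single i 1) :=
    fun i m l => (R.differentiableAt_signal hrx htx m l).lineDifferentiableAt
  have hlog := fun i y => MIMORadar.hasDerivAt_log_likelihood (R := R) hQpos (hQ i) (hS i) y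
  have hp := hQpos.self_of_nhds
  have hscore : ∀ i y, score (R.likelihood Q) θ y i = _ := fun i y => (hlog i y).deriv
  have hlaw := R.receivedLaw_eq Q θ hp
  have hherm := fun i => MIMORadar.isHermitian_matrixPartialDeriv hQpos (hQ i)
  have hC := MIMORadar.posDef_blockCov L hp
  have hfim : ∀ i j, ((R.fim Q θ i j : ℝ) : ℂ) =
      (L : ℂ) * ((Q (nuisance θ))⁻¹ * matrixPartialDeriv i (fun ϑ => Q (nuisance ϑ)) θ *
          (Q (nuisance θ))⁻¹ * matrixPartialDeriv j (fun ϑ => Q (nuisance ϑ)) θ).trace +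
        ((2 * ((matrixPartialDeriv i R.signal θ).conjTranspose * (Q (nuisance θ))⁻¹ *
          matrixPartialDeriv j R.signal θ).trace.re : ℝ) : ℂ) := by
    intro i j
    rw [MIMORadar.fim, fisherInformation, Matrix.of_apply]
    simp only [hscore]
    rw [hlaw, integral_gaussianScore_mul hC _ _ _ (MIMORadar.isHermitian_blockCov (hherm i))
      (MIMORadar.isHermitian_blockCov (hherm j)), MIMORadar.blockCov_inv,
      MIMORadar.star_vec_dotProduct_blockCov_mulVec_vec]
    simp only [MIMORadar.blockCov_mul, MIMORadar.trace_blockCov]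
    -- The stated formula has no real part on the first trace, which is legitimate because that
    -- trace is real.
    rw [Complex.ofReal_add, ← Complex.ofReal_natCast, Complex.re_ofReal_mul, Complex.ofReal_mul,
      hp.inv.isHermitian.ofReal_re_trace_mul (hherm i) (hherm j)]
  refine ⟨fun ϑ => R.receivedLaw_eq Q ϑ, hS, hQ,
    fun i y => (hlog i y).differentiableAt, fun i j => ?_, hfim, fun i j => ⟨?_, ?_⟩⟩
  -- Both scores are square integrable, so their product is integrable.
  · simp only [hscore, hlaw]
    exact (memLp_gaussianScore hC _ _ (MIMORadar.isHermitian_blockCov (hherm i))).integrable_mul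
      (memLp_gaussianScore hC _ _ (MIMORadar.isHermitian_blockCov (hherm j)))
  · have h := hfim (Sum.inl i) (Sum.inr j)
    rw [MIMORadar.matrixPartialDeriv_nuisance_inl, R.matrixPartialDeriv_signal_inr] at h
    exact Complex.ofReal_eq_zero.1 (h.trans (by simp))
  · have h := hfim (Sum.inr j) (Sum.inl i)
    rw [MIMORadar.matrixPartialDeriv_nuisance_inl, R.matrixPartialDeriv_signal_inr] at h
    exact Complex.ofReal_eq_zero.1 (h.trans (by simp))
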